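/- Let $k$ be a number field and let $F$ be an étale $k$-algebra (a finite product of finite separable field extensions of $k$); all tensor products are over $k$. For $n \ge 0$, the algebra $F^{\otimes n+1}$ is again étale. For an étale $k$-algebra $A \simeq A_1\times\dots\times A_r$ with all $A_i$ number fields, a non-archimedean place of $A$ is a non-archimedean place of one of the factors $A_i$, the divisor group of $A$ is the free abelian group on these places, the divisor $\operatorname{div}(a)$ of $a \in A^\times$ is the sum of the divisors of its components in the factors $A_i$, and $\mathrm{Cl}(A)$ is the group of divisors modulo divisors of elements of $A^\times$. For a set $S$ of non-archimedean places of $k$, let $S^{(n)}$ be the set of non-archimedean places of $F^{\otimes n+1}$ lying above some place in $S$. Let $\Delta^1_{Am} \colon (F^{\otimes 2})^\times \to (F^{\otimes 3})^\times$ be the Amitsur differential $a \mapsto \varepsilon_0(a)\,\varepsilon_1(a)^{-1}\,\varepsilon_2(a)$, where $\varepsilon_0,\varepsilon_1,\varepsilon_2\colon F^{\otimes 2} \to F^{\otimes 3}$ are the $k$-algebra homomorphisms sending $x\otimes y$ to $1\otimes x\otimes y$, $x\otimes 1\otimes y$ and $x\otimes y\otimes 1$ respectively, and let $B^2_{Am}(k,F)$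 be the image of $\Delta^1_{Am}$. **Theorem.** Let $b \in B^2_{Am}(k,F)$ and let $S$ be a set of non-archimedean places of $k$ such that - $S$ contains every place of $k$ that ramifies in $F$ (that is, in one of the field factors of $F$); - the classes of the places in $S^{(0)}$ generate $\mathrm{Cl}(F)$; - the support of $\operatorname{div}(b)$ is contained in $S^{(2)}$. Then there is an $S^{(1)}$-unit $a$ of $F^{\otimes 2}$, that is, an element $a \in (F^{\otimes 2})^\times$ whose divisor is supported in $S^{(1)}$, such that $b = \Delta^1_{Am}(a)$. -/

import Mathlib

open scoped NumberField TensorProduct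
open IsDedekindDomain

noncomputable section

namespace AmitsurEtale

universe u v

/-- The group of invertible elements of a commutative ring (the abbreviation fixes the multiplicative
structure to be the one underlying the `CommRing` instance). -/
abbrev UnitGroup (A : Type*) [CommRing A] := Aˣ

section Places

theorem finite_of_etale (k : Type u) [Field k] (A : Type v) [CommRing A] [Algebra k A]
    [Algebra.Etale k A] : Module.Finite k A :=
  Algebra.FormallyUnramified.finite_of_free k A

variable (k : Type u) [Field k] [NumberField k] (A : Type v) [CommRing A] [Algebra k A]

/-- The field factors `A ⧸ m` of an étale `k`-algebra `A ≃ ∏ A ⧸ m`, indexed by the maximal ideals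
`m` of `A` (the projection onto the factor is the quotient map). The base field `k` is recorded in
the type only so that the `k`-algebra structure can be found by instance resolution. -/
@[nolint unusedArguments]
def Factor (_ : Algebra k A) (m : MaximalSpectrum A) : Type v := A ⧸ m.asIdeal

variable {k A} in
/-- The factor at `m` of the `k`-algebra `A`. -/
abbrev Fac (k : Type u) [Field k] {A : Type v} [CommRing A] [alg : Algebra k A]
    (m : MaximalSpectrum A) : Type v := Factor k A alg m

instance (m : MaximalSpectrum A) : CommRing (Fac k m) :=
  inferInstanceAs (CommRing (A ⧸ m.asIdeal))

instance (m : MaximalSpectrum A) : Field (Fac k m) :=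
  { (inferInstance : CommRing (Fac k m)),
    (letI := m.isMaximal
     Ideal.Quotient.field m.asIdeal : Field (A ⧸ m.asIdeal)) with }

instance (m : MaximalSpectrum A) : Algebra A (Fac k m) :=
  inferInstanceAs (Algebra A (A ⧸ m.asIdeal))

instance (m : MaximalSpectrum A) : Algebra k (Fac k m) :=
  inferInstanceAs (Algebra k (A ⧸ m.asIdeal))

instance (m : MaximalSpectrum A) : IsScalarTower k A (Fac k m) :=
  inferInstanceAs (IsScalarTower k A (A ⧸ m.asIdeal))

instance [Algebra.Etale k A] (m : MaximalSpectrum A) : NumberField (Fac k m) := by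
  have := finite_of_etale k A
  have : Module.Finite k (Fac k m) :=
    inferInstanceAs (Module.Finite k (A ⧸ m.asIdeal))
  have : CharZero (Fac k m) := charZero_of_injective_algebraMap (algebraMap k (Fac k m)).injective
  have : IsScalarTower ℚ k (Fac k m) :=
    IsScalarTower.of_algebraMap_eq' (RingHom.ext_rat _ _)
  exact { to_charZero := inferInstance
          to_finiteDimensional := Module.Finite.trans k (Fac k m) }

/-- A non-archimedean place of the étale `k`-algebra `A`: a choice of one of the field factors of
`A`, together with a finite place (nonzero prime of the ring of integers) of this number field. -/
structure Place where
  /-- The maximal ideal of `A` cutting out the factor. -/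
  factor : MaximalSpectrum A
  /-- The finite place of the factor. -/
  prime : HeightOneSpectrum (𝓞 (Fac k factor))

/-- Divisors of `A`: the free abelian group on the non-archimedean places. -/
abbrev Div : Type v := Place k A →₀ ℤ

variable {k A}

/-- The place `Q` of `A` lies above the finite place `p` of `k`. -/
def Place.LiesAbove (Q : Place k A) (p : HeightOneSpectrum (𝓞 k)) : Prop :=
  Q.prime.asIdeal.LiesOver p.asIdeal

/-- The ramification index of the place `Q` of `A` over `k`. -/
def Place.ramificationIdx (Q : Place k A) : ℕ :=
  Q.prime.asIdeal.ramificationIdx (𝓞 k)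

variable (A) in
/-- The finite place `p` of `k` ramifies in `A`. -/
def Ramifies (p : HeightOneSpectrum (𝓞 k)) : Prop :=
  ∃ Q : Place k A, Q.LiesAbove p ∧ Q.ramificationIdx ≠ 1

variable (A) in
/-- The places of `A` lying above some place in `S`. -/
def placesAbove (S : Set (HeightOneSpectrum (𝓞 k))) : Set (Place k A) :=
  {Q | ∃ p ∈ S, Q.LiesAbove p}

variable [Algebra.Etale k A]

/-- The normalised order of `a : A` at the place `Q`: the additive `Q`-adic valuation of the image
of `a` in the factor of `A` to which `Q` belongs. -/
def Place.ord (Q : Place k A) (a : A) : ℤ :=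
  -WithZero.log (Q.prime.valuation (Fac k Q.factor) (algebraMap A (Fac k Q.factor) a))

theorem Place.map_unit_ne_zero (Q : Place k A) (a : UnitGroup A) :
    algebraMap A (Fac k Q.factor) a ≠ 0 :=
  (a.isUnit.map (algebraMap A (Fac k Q.factor))).ne_zero

theorem Place.ord_one (Q : Place k A) : Q.ord 1 = 0 := by
  simp [Place.ord]

theorem Place.ord_mul (Q : Place k A) (a b : UnitGroup A) :
    Q.ord ((a * b : UnitGroup A) : A) = Q.ord a + Q.ord b := by
  simp only [Place.ord, Units.val_mul, map_mul]
  rw [WithZero.log_mul, neg_add]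
  · simpa using Q.map_unit_ne_zero a
  · simpa using Q.map_unit_ne_zero b

theorem finite_ord_ne_zero (a : UnitGroup A) : {Q : Place k A | Q.ord a ≠ 0}.Finite := by
  have := finite_of_etale k A
  have : IsArtinianRing A := IsArtinianRing.of_finite k A
  have key : ∀ m : MaximalSpectrum A,
      {w : HeightOneSpectrum (𝓞 (Fac k m)) | (Place.mk m w).ord a ≠ 0}.Finite := by
    intro m
    set x : Fac k m := algebraMap A (Fac k m) a with hx
    have hx0 : x ≠ 0 := (a.isUnit.map (algebraMap A (Fac k m))).ne_zero
    refine ((HeightOneSpectrum.Support.finite (𝓞 (Fac k m)) x).union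
      (HeightOneSpectrum.Support.finite (𝓞 (Fac k m)) x⁻¹)).subset ?_
    intro w hw
    have hv0 : w.valuation (Fac k m) x ≠ 0 := by simpa using hx0
    have hw1 : w.valuation (Fac k m) x ≠ 1 := by
      intro h
      apply hw
      simp only [Place.ord]
      rw [← hx, h]
      simp
    rcases lt_or_gt_of_ne hw1 with h | h
    · right
      change 1 < w.valuation (Fac k m) x⁻¹
      rw [map_inv₀]
      exact (one_lt_inv₀ (zero_lt_iff.2 hv0)).2 h
    · left
      exact h
  refine (Set.finite_iUnion (fun m => (key m).image (Place.mk m))).subset ?_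
  rintro ⟨m, w⟩ h
  exact Set.mem_iUnion.2 ⟨m, w, h, rfl⟩

variable (k A)

/-- The divisor `∑ ord_Q(a) Q` of an invertible element `a`, as a group homomorphism. -/
def div : Additive (UnitGroup A) →+ Div k A :=
  AddMonoidHom.mk'
    (fun a => Finsupp.ofSupportFinite (fun Q => Q.ord (a.toMul : A)) (finite_ord_ne_zero a.toMul))
    (fun a b => Finsupp.ext fun Q => Q.ord_mul a.toMul b.toMul)

/-- The class group of `A`: divisors modulo principal divisors. -/
abbrev Cl : Type v := Div k A ⧸ (div k A).range

/-- The set `T` of places of `A` generates the class group of `A`. -/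
def GeneratesCl (T : Set (Place k A)) : Prop :=
  AddSubgroup.closure
    ((fun Q : Place k A => (QuotientAddGroup.mk (Finsupp.single Q 1) : Cl k A)) '' T) = ⊤

variable {k A}

/-- The support of the divisor of an invertible element. -/
def divSupport (a : UnitGroup A) : Set (Place k A) :=
  {Q | Q ∈ (div k A (Additive.ofMul a)).support}

theorem mem_divSupport {a : UnitGroup A} {Q : Place k A} : Q ∈ divSupport a ↔ Q.ord (a : A) ≠ 0 := by
  simp only [divSupport, Set.mem_ofPred_eq, Finsupp.mem_support_iff]
  rfl

/-- The group of `T`-units of `A`: invertible elements whose divisor is supported in `T`. -/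
def sUnits (T : Set (Place k A)) : Subgroup (UnitGroup A) where
  carrier := {a | divSupport a ⊆ T}
  one_mem' Q hQ := by
    have h := mem_divSupport.1 hQ
    rw [Units.val_one] at h
    exact absurd Q.ord_one h
  mul_mem' {a b} ha hb Q hQ := by
    by_contra hT
    have h1 : Q.ord (a : A) = 0 := by
      by_contra h
      exact hT (ha (mem_divSupport.2 h))
    have h2 : Q.ord (b : A) = 0 := by
      by_contra h
      exact hT (hb (mem_divSupport.2 h))
    exact mem_divSupport.1 hQ (by rw [Q.ord_mul, h1, h2, add_zero])
  inv_mem' {a} ha Q hQ := by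
    refine ha (mem_divSupport.2 fun h => mem_divSupport.1 hQ ?_)
    have := Q.ord_mul a a⁻¹
    rw [mul_inv_cancel, h, zero_add, Units.val_one, Q.ord_one] at this
    exact this.symm

end Places

section Amitsur

variable {k : Type*} [Field k] in
/-- The homomorphism `a ↦ f₀(a) f₁(a)⁻¹ f₂(a)` on groups of units. -/
def alternatingProduct {A B : Type*} [CommRing A] [CommRing B] [Algebra k A] [Algebra k B]
    (f₀ f₁ f₂ : A →ₐ[k] B) : UnitGroup A →* UnitGroup B :=
  Units.map (f₀ : A →* B) * (Units.map (f₁ : A →* B))⁻¹ * Units.map (f₂ : A →* B)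

theorem alternatingProduct_apply {k A B : Type*} [Field k] [CommRing A] [CommRing B] [Algebra k A]
    [Algebra k B] (f₀ f₁ f₂ : A →ₐ[k] B) (a : UnitGroup A) :
    alternatingProduct f₀ f₁ f₂ a =
      Units.map (f₀ : A →* B) a * (Units.map (f₁ : A →* B) a)⁻¹ * Units.map (f₂ : A →* B) a :=
  rfl

variable (k : Type u) [Field k] (F : Type v) [CommRing F] [Algebra k F]

/-- The coface map `ε₀ : F ⊗ F → F ⊗ F ⊗ F`, `x ⊗ y ↦ 1 ⊗ x ⊗ y`. -/
def ε₀ : F ⊗[k] F →ₐ[k] F ⊗[k] F ⊗[k] F :=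
  Algebra.TensorProduct.map Algebra.TensorProduct.includeRight (AlgHom.id k F)

/-- The coface map `ε₁ : F ⊗ F → F ⊗ F ⊗ F`, `x ⊗ y ↦ x ⊗ 1 ⊗ y`. -/
def ε₁ : F ⊗[k] F →ₐ[k] F ⊗[k] F ⊗[k] F :=
  Algebra.TensorProduct.map Algebra.TensorProduct.includeLeft (AlgHom.id k F)

/-- The coface map `ε₂ : F ⊗ F → F ⊗ F ⊗ F`, `x ⊗ y ↦ x ⊗ y ⊗ 1`. -/
def ε₂ : F ⊗[k] F →ₐ[k] F ⊗[k] F ⊗[k] F :=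
  Algebra.TensorProduct.includeLeft

theorem ε₀_tmul (x y : F) : ε₀ k F (x ⊗ₜ y) = 1 ⊗ₜ x ⊗ₜ y := rfl

theorem ε₁_tmul (x y : F) : ε₁ k F (x ⊗ₜ y) = x ⊗ₜ 1 ⊗ₜ y := rfl

theorem ε₂_tmul (x y : F) : ε₂ k F (x ⊗ₜ y) = x ⊗ₜ y ⊗ₜ 1 := rfl

/-- Amitsur `1`-cochains: the group `(F ⊗ F)ˣ`. -/
abbrev C₁ : Type v := UnitGroup (F ⊗[k] F)

/-- Amitsur `2`-cochains: the group `(F ⊗ F ⊗ F)ˣ`. -/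
abbrev C₂ : Type v := UnitGroup (F ⊗[k] F ⊗[k] F)

/-- The Amitsur differential `Δ¹ : (F ⊗ F)ˣ → (F ⊗ F ⊗ F)ˣ`, `a ↦ ε₀(a) ε₁(a)⁻¹ ε₂(a)`, from
`1`-cochains to `2`-cochains. -/
def Δ₁ : C₁ k F →* C₂ k F :=
  alternatingProduct (ε₀ k F) (ε₁ k F) (ε₂ k F)

/-- The group of Amitsur `2`-coboundaries. -/
def B₂ : Subgroup (C₂ k F) := (Δ₁ k F).range

instance [Algebra.Etale k F] : Algebra.Etale k (F ⊗[k] F) :=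
  Algebra.Etale.comp k F (F ⊗[k] F)

instance [Algebra.Etale k F] : Algebra.Etale k (F ⊗[k] F ⊗[k] F) :=
  Algebra.Etale.comp k (F ⊗[k] F) (F ⊗[k] F ⊗[k] F)

end Amitsur

end AmitsurEtale

end

open scoped NumberField TensorProduct Pointwise

set_option linter.unusedSectionVars false

noncomputable section

namespace AmitsurEtale

/-! ### Galois action on primes, inertia and valuations -/

section Galois

variable {K L : Type*} [Field K] [NumberField K] [Field L] [NumberField L] [Algebra K L]

/-! Write `b = Δ₁ a₀`. Since `Δ₁ ∘ Δ₀ = 1`, it suffices to find a unit `c` of `F` such that `a₀ / Δ₀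
c` has trivial order at all places outside `S`.

Let `L` be the Galois extension of `k` generated by the images of `F`. It is unramified outside `S`
(`ramificationIdx_eq_one_of_forall`), so for `p ∉ S` and a prime `P` of `L` above `p`, orders in
`F`, `F ⊗ F` and `F ⊗ F ⊗ F` can be read off in `L` without rescaling. Let `f(x, y)` be the order at
`P` of the image of `a₀` under a pair `x, y : F → L`. As `b` has order zero above `p`, `f(y, z) -
f(x, z) + f(x, y) = 0`, so `f(x, y) = g(y) - g(x)` with `g(x) = f(x₀, x)` for a fixed `x₀`.

The places of `F` above `p` are the orbits of the decomposition group of `P` on the homomorphisms `F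
→ L`, so `g` is a divisor of `F` once it is invariant. The defect `g(σ x) - g(x) = f(x, σ x)`
vanishes because `σ` has finite order and `ℤ` is torsion-free (`pairOrd_galois_self`). The
generation of the class group then provides `c` with this divisor outside `S`
(`GeneratesCl.exists_ord_eq`). -/

theorem isGaloisGroup_ringOfIntegers [IsGalois K L] : IsGaloisGroup Gal(L/K) (𝓞 K) (𝓞 L) :=
  IsGaloisGroup.of_isFractionRing _ _ _ K L

theorem exists_smul_eq_of_under_eq [IsGalois K L] (P P' : Ideal (𝓞 L)) [P.IsPrime] [P'.IsPrime]
    (h : P.under (𝓞 K) = P'.under (𝓞 K)) : ∃ σ : Gal(L/K), σ • P = P' := by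
  have := isGaloisGroup_ringOfIntegers (K := K) (L := L)
  have : P'.LiesOver (P.under (𝓞 K)) := ⟨h⟩
  exact Ideal.exists_smul_eq_of_isGaloisGroup (P.under (𝓞 K)) P P' _

theorem intValuation_smul (σ : Gal(L/K)) {P P' : HeightOneSpectrum (𝓞 L)}
    (h : σ • P.asIdeal = P'.asIdeal) (r : 𝓞 L) :
    P'.intValuation (σ • r) = P.intValuation r := by
  by_cases hr : r = 0
  · simp [hr]
  have hr' : σ • r ≠ 0 := fun h0 => hr (by simpa using congrArg (σ⁻¹ • ·) h0)
  have hspan : Ideal.span {σ • r} = σ • Ideal.span {r} := by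
    rw [Ideal.pointwise_smul_def, Ideal.map_span, Set.image_singleton]
    rfl
  have key : multiplicity P'.asIdeal (Ideal.span {σ • r}) =
      multiplicity P.asIdeal (Ideal.span {r}) := by
    rw [hspan, ← h]
    exact multiplicity_map_eq (MulDistribMulAction.toMulEquiv (Ideal (𝓞 L)) σ)
  rw [HeightOneSpectrum.intValuation_eq_exp_neg_multiplicity _ hr,
    HeightOneSpectrum.intValuation_eq_exp_neg_multiplicity _ hr', key]

theorem valuation_galois (σ : Gal(L/K)) {P P' : HeightOneSpectrum (𝓞 L)}
    (h : σ • P.asIdeal = P'.asIdeal) (z : L) :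
    P'.valuation L (σ z) = P.valuation L z := by
  obtain ⟨x, y, -, rfl⟩ := IsFractionRing.div_surjective (A := 𝓞 L) z
  have hσ : ∀ r : 𝓞 L, σ (algebraMap (𝓞 L) L r) = algebraMap (𝓞 L) L (σ • r) := fun _ => rfl
  simp only [map_div₀, hσ, HeightOneSpectrum.valuation_of_algebraMap, intValuation_smul σ h]

variable {k : Type*} [Field k] [NumberField k] [Algebra k K] [Algebra k L] [IsScalarTower k K L]

theorem card_inertia_eq_ramificationIdx (P : HeightOneSpectrum (𝓞 L)) [IsGalois K L] :
    Nat.card (P.asIdeal.inertia Gal(L/K)) = P.asIdeal.ramificationIdx (𝓞 K) := by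
  have := isGaloisGroup_ringOfIntegers (K := K) (L := L)
  let p := P.under (𝓞 K)
  have : P.asIdeal.LiesOver p.asIdeal := ⟨rfl⟩
  rw [Ideal.card_inertia_eq_ramificationIdxIn p.asIdeal P.asIdeal,
    Ideal.ramificationIdxIn_eq_ramificationIdx p.asIdeal P.asIdeal Gal(L/K)]

/-- The inertia group fixes every intermediate field in which the prime below is unramified. -/
theorem inertia_fixes_of_unramified [IsGalois k L] (P : HeightOneSpectrum (𝓞 L))
    (h : (P.under (𝓞 K)).asIdeal.ramificationIdx (𝓞 k) = 1) {σ : Gal(L/k)}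
    (hσ : σ ∈ P.asIdeal.inertia Gal(L/k)) (x : K) : σ (algebraMap K L x) = algebraMap K L x := by
  have : IsGalois K L := IsGalois.tower_top_of_isGalois k K L
  have : P.asIdeal.LiesOver (P.under (𝓞 K)).asIdeal := ⟨rfl⟩
  -- Inertia orders are ramification indices, which multiply in towers. The inertia group over `K`
  -- embeds in the one over `k` and has the same order, so it is all of it.
  have hcard : Nat.card (P.asIdeal.inertia Gal(L/K)) = Nat.card (P.asIdeal.inertia Gal(L/k)) := by
    rw [card_inertia_eq_ramificationIdx, card_inertia_eq_ramificationIdx,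
      Ideal.ramificationIdx_tower (R := 𝓞 k) (P.under (𝓞 K)).asIdeal P.asIdeal, h, one_mul]
  let f : P.asIdeal.inertia Gal(L/K) → P.asIdeal.inertia Gal(L/k) := fun τ =>
    ⟨τ.1.restrictScalars k, fun x => τ.2 x⟩
  have hf : Function.Injective f := fun τ τ' hτ => by
    ext x
    exact DFunLike.congr_fun (congrArg Subtype.val hτ) x
  obtain ⟨τ, hτ⟩ := ((Nat.bijective_iff_injective_and_card f).2 ⟨hf, hcard⟩).2 ⟨σ, hσ⟩
  have h1 : σ (algebraMap K L x) = τ.1 (algebraMap K L x) :=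
    (DFunLike.congr_fun (congrArg Subtype.val hτ) (algebraMap K L x)).symm
  rw [h1, AlgEquiv.commutes]

theorem ramificationIdx_eq_one_of_tower (P : HeightOneSpectrum (𝓞 L))
    (h : P.asIdeal.ramificationIdx (𝓞 k) = 1) : P.asIdeal.ramificationIdx (𝓞 K) = 1 := by
  have : P.asIdeal.LiesOver (P.under (𝓞 K)).asIdeal := ⟨rfl⟩
  rw [Ideal.ramificationIdx_tower (R := 𝓞 k) (P.under (𝓞 K)).asIdeal P.asIdeal] at h
  exact Nat.eq_one_of_mul_eq_one_left h

theorem valuation_under_of_unramified (P : HeightOneSpectrum (𝓞 L))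
    (h : P.asIdeal.ramificationIdx (𝓞 K) = 1) (x : K) :
    P.valuation L (algebraMap K L x) = (P.under (𝓞 K)).valuation K x := by
  have : P.asIdeal.LiesOver (P.under (𝓞 K)).asIdeal := ⟨rfl⟩
  rw [← HeightOneSpectrum.valuation_liesOver L (P.under (𝓞 K)) P,
    Ideal.ramificationIdx'_eq_ramificationIdx _ _ (P.under (𝓞 K)).ne_bot, h, pow_one]

/-- The normalised additive valuation of `z` at `P`. -/
def primeOrd (P : HeightOneSpectrum (𝓞 L)) (z : L) : ℤ := -WithZero.log (P.valuation L z)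

theorem primeOrd_mul (P : HeightOneSpectrum (𝓞 L)) {x y : L} (hx : x ≠ 0) (hy : y ≠ 0) :
    primeOrd P (x * y) = primeOrd P x + primeOrd P y := by
  rw [primeOrd, map_mul, WithZero.log_mul (by simpa using hx) (by simpa using hy), neg_add]
  rfl

theorem primeOrd_inv (P : HeightOneSpectrum (𝓞 L)) (x : L) :
    primeOrd P x⁻¹ = -primeOrd P x := by
  simp [primeOrd]

theorem primeOrd_galois (σ : Gal(L/K)) {P : HeightOneSpectrum (𝓞 L)}
    (h : σ • P.asIdeal = P.asIdeal) (z : L) : primeOrd P (σ z) = primeOrd P z := by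
  rw [primeOrd, primeOrd, valuation_galois σ h]

end Galois

/-! ### Places of an étale algebra induced by primes of a field -/

section Below

variable {k : Type*} [Field k] [NumberField k] {A : Type*} [CommRing A] [Algebra k A]
  {L : Type*} [Field L] [NumberField L] [Algebra k L]

/-- The place `Q` of `A` is induced by the prime `P` of `L` along the homomorphism `φ : A → L`. -/
def Place.IsInduced (Q : Place k A) (φ : A →ₐ[k] L) (P : HeightOneSpectrum (𝓞 L)) : Prop :=
  ∃ ι : Fac k Q.factor →ₐ[k] L, (∀ a, ι (algebraMap A _ a) = φ a) ∧
    Q.prime.asIdeal = P.asIdeal.comap (NumberField.RingOfIntegers.mapRingHom (ι : _ →+* L))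

theorem algebraMap_factor_surjective (m : MaximalSpectrum A) :
    Function.Surjective (algebraMap A (Fac k m)) :=
  Ideal.Quotient.mk_surjective

variable [Algebra.Etale k A]

theorem Place.exists_isInduced (φ : A →ₐ[k] L) (P : HeightOneSpectrum (𝓞 L)) :
    ∃ Q : Place k A, Q.IsInduced φ P := by
  have := finite_of_etale k A
  have : IsArtinianRing A := IsArtinianRing.of_finite k A
  have hp : (RingHom.ker φ).IsPrime := RingHom.ker_isPrime φ
  let m : MaximalSpectrum A := ⟨RingHom.ker φ, IsArtinianRing.isMaximal_of_isPrime _⟩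
  let ι : Fac k m →ₐ[k] L := Ideal.Quotient.liftₐ (RingHom.ker φ) φ fun _ h => h
  let : Algebra (Fac k m) L := (ι : Fac k m →+* L).toAlgebra
  exact ⟨⟨m, P.under _⟩, ι, fun a => rfl, rfl⟩

theorem Place.IsInduced.unique {Q Q' : Place k A} {φ : A →ₐ[k] L} {P : HeightOneSpectrum (𝓞 L)}
    (h : Q.IsInduced φ P) (h' : Q'.IsInduced φ P) : Q = Q' := by
  have hker : ∀ {R : Place k A}, R.IsInduced φ P → R.factor.asIdeal = RingHom.ker φ := by
    rintro R ⟨ι, hι, -⟩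
    ext a
    rw [RingHom.mem_ker, ← hι, map_eq_zero_iff ι (RingHom.injective _)]
    exact Ideal.Quotient.eq_zero_iff_mem.symm
  have hm : Q.factor = Q'.factor := MaximalSpectrum.ext ((hker h).trans (hker h').symm)
  obtain ⟨m, q⟩ := Q
  obtain ⟨m', q'⟩ := Q'
  obtain rfl : m = m' := hm
  obtain ⟨ι, hι, hq⟩ := h
  obtain ⟨ι', hι', hq'⟩ := h'
  obtain rfl : ι = ι' := by
    ext x
    obtain ⟨a, rfl⟩ := algebraMap_factor_surjective (k := k) m x
    rw [hι, hι']
  congr 1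
  exact HeightOneSpectrum.ext (hq.trans hq'.symm)

theorem Place.IsInduced.liesAbove {Q : Place k A} {φ : A →ₐ[k] L} {P : HeightOneSpectrum (𝓞 L)}
    (h : Q.IsInduced φ P) : Q.LiesAbove (P.under (𝓞 k)) := by
  obtain ⟨ι, hι, hq⟩ := h
  let : Algebra (Fac k Q.factor) L := (ι : _ →+* L).toAlgebra
  have : IsScalarTower k (Fac k Q.factor) L := IsScalarTower.of_algebraMap_eq' ι.comp_algebraMap.symm
  refine ⟨?_⟩
  rw [hq]
  exact (Ideal.under_under (A := 𝓞 k) (B := 𝓞 (Fac k Q.factor)) P.asIdeal).symm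

theorem Place.IsInduced.ord_eq {Q : Place k A} {φ : A →ₐ[k] L} {P : HeightOneSpectrum (𝓞 L)}
    (h : Q.IsInduced φ P) (hP : P.asIdeal.ramificationIdx (𝓞 k) = 1) (a : A) :
    Q.ord a = primeOrd P (φ a) := by
  obtain ⟨ι, hι, hq⟩ := h
  let : Algebra (Fac k Q.factor) L := (ι : _ →+* L).toAlgebra
  have : IsScalarTower k (Fac k Q.factor) L := IsScalarTower.of_algebraMap_eq' ι.comp_algebraMap.symm
  have hQ : Q.prime = P.under (𝓞 (Fac k Q.factor)) := HeightOneSpectrum.ext hq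
  rw [Place.ord, primeOrd, hQ, ← valuation_under_of_unramified P
    (ramificationIdx_eq_one_of_tower (k := k) P hP), ← hι]
  rfl

/-- The two embeddings of the factor of `Q` differ by some `τ` in `Gal(L/k)`. Since `P` and `τ⁻¹ P`
lie over the same prime of the factor, an automorphism `ρ` over the factor carries one to the other,
and `τ ρ` stabilises `P`. -/
theorem Place.IsInduced.exists_galois [IsGalois k L] {Q : Place k A} {φ φ' : A →ₐ[k] L}
    {P : HeightOneSpectrum (𝓞 L)} (h : Q.IsInduced φ P) (h' : Q.IsInduced φ' P) :
    ∃ σ : Gal(L/k), σ • P.asIdeal = P.asIdeal ∧ ∀ a, φ' a = σ (φ a) := by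
  obtain ⟨ι, hι, hq⟩ := h
  obtain ⟨ι', hι', hq'⟩ := h'
  let : Algebra (Fac k Q.factor) L := (ι : _ →+* L).toAlgebra
  have : IsScalarTower k (Fac k Q.factor) L := IsScalarTower.of_algebraMap_eq' ι.comp_algebraMap.symm
  have : IsGalois (Fac k Q.factor) L := IsGalois.tower_top_of_isGalois k _ L
  let τ : Gal(L/k) := AlgEquiv.ofBijective (ι'.liftNormal L)
    (Algebra.IsAlgebraic.algHom_bijective (ι'.liftNormal L))
  have hτ : ∀ x, τ (ι x) = ι' x := fun x => ι'.liftNormal_commutes L x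
  obtain ⟨ρ, hρ⟩ : ∃ ρ : Gal(L/Fac k Q.factor), ρ • P.asIdeal = τ⁻¹ • P.asIdeal := by
    have : (τ⁻¹ • P.asIdeal).IsPrime := inferInstance
    refine exists_smul_eq_of_under_eq _ _ ?_
    refine hq.symm.trans (hq'.trans ?_)
    ext z
    rw [Ideal.mem_comap, Ideal.under, Ideal.mem_comap, Ideal.mem_inv_pointwise_smul_iff]
    convert Iff.rfl using 2
    exact NumberField.RingOfIntegers.ext (hτ z)
  refine ⟨τ * ρ.restrictScalars k, ?_, fun a => ?_⟩
  · rw [mul_smul]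
    exact (congrArg (τ • ·) hρ).trans (smul_inv_smul _ _)
  · rw [← hι, ← hι', ← hτ]
    exact congrArg τ (ρ.commutes _).symm

theorem Place.exists_isInduced_of_liesAbove [IsGalois k L] {Q : Place k A}
    (hQ : Nonempty (Fac k Q.factor →ₐ[k] L)) {P : HeightOneSpectrum (𝓞 L)}
    (h : Q.LiesAbove (P.under (𝓞 k))) : ∃ φ : A →ₐ[k] L, Q.IsInduced φ P := by
  obtain ⟨ι⟩ := hQ
  let : Algebra (Fac k Q.factor) L := (ι : _ →+* L).toAlgebra
  have : IsScalarTower k (Fac k Q.factor) L := IsScalarTower.of_algebraMap_eq' ι.comp_algebraMap.symm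
  obtain ⟨P', hP', hover⟩ := Ideal.exists_maximal_ideal_liesOver_of_isIntegral (S := 𝓞 L)
    Q.prime.asIdeal
  obtain ⟨σ, hσ⟩ : ∃ σ : Gal(L/k), σ • P' = P.asIdeal := by
    refine exists_smul_eq_of_under_eq _ _ ?_
    rw [← Ideal.under_under (B := 𝓞 (Fac k Q.factor)), ← hover.over]
    exact h.over.symm
  refine ⟨((σ : L →ₐ[k] L).comp ι).comp (IsScalarTower.toAlgHom k A _), (σ : L →ₐ[k] L).comp ι,
    fun _ => rfl, ?_⟩
  rw [hover.over]
  ext z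
  change algebraMap (𝓞 (Fac k Q.factor)) (𝓞 L) z ∈ P' ↔ _ ∈ P.asIdeal
  rw [← hσ, ← Ideal.smul_mem_pointwise_smul_iff (a := σ)]
  rfl

/-- A prime of a Galois extension which is generated by the images of `A` is unramified
over `k` if the places of `A` below it are. -/
theorem ramificationIdx_eq_one_of_forall [IsGalois k L]
    (hL : ∀ σ : Gal(L/k), (∀ (φ : A →ₐ[k] L) a, σ (φ a) = φ a) → σ = 1)
    {P : HeightOneSpectrum (𝓞 L)} (h : ¬ Ramifies A (P.under (𝓞 k))) :
    P.asIdeal.ramificationIdx (𝓞 k) = 1 := by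
  -- It is enough that inertia is trivial, and for this that it fixes the image of every `φ`.
  rw [← card_inertia_eq_ramificationIdx (K := k), Subgroup.card_eq_one, Subgroup.eq_bot_iff_forall]
  refine fun σ hσ => hL σ fun φ a => ?_
  obtain ⟨Q, hQ⟩ := Place.exists_isInduced φ P
  have he : Q.ramificationIdx = 1 := by
    by_contra h1
    exact h ⟨Q, hQ.liesAbove, h1⟩
  obtain ⟨ι, hι, hq⟩ := hQ
  let : Algebra (Fac k Q.factor) L := (ι : _ →+* L).toAlgebra
  have : IsScalarTower k (Fac k Q.factor) L := IsScalarTower.of_algebraMap_eq' ι.comp_algebraMap.symm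
  have hQ : Q.prime = P.under (𝓞 (Fac k Q.factor)) := HeightOneSpectrum.ext hq
  rw [← hι]
  refine inertia_fixes_of_unramified P ?_ hσ _
  rw [← hQ]
  exact he

end Below

/-! ### Divisors modulo principal divisors -/

section Divisors

variable {k : Type*} [Field k] [NumberField k] {A : Type*} [CommRing A] [Algebra k A]
  [Algebra.Etale k A]

/-- If the places in `T` generate the class group, then every divisor agrees outside `T` with a
principal divisor. -/
theorem GeneratesCl.exists_ord_eq {T : Set (Place k A)} (hT : GeneratesCl k A T) (E : Div k A) :
    ∃ c : UnitGroup A, ∀ Q ∉ T, Q.ord (c : A) = E Q := by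
  obtain ⟨e, he, hmk⟩ : ∃ e ∈ AddSubgroup.closure ((fun Q : Place k A => Finsupp.single Q (1 : ℤ)) '' T),
      QuotientAddGroup.mk' (div k A).range e = QuotientAddGroup.mk' (div k A).range E := by
    rw [← AddSubgroup.mem_map, AddMonoidHom.map_closure, Set.image_image]
    have h : QuotientAddGroup.mk' (div k A).range E ∈ (⊤ : AddSubgroup (Cl k A)) := trivial
    rw [← hT] at h
    exact h
  have hsupp : ∀ Q ∉ T, e Q = 0 := by
    intro Q hQ
    have hle : AddSubgroup.closure ((fun Q : Place k A => Finsupp.single Q (1 : ℤ)) '' T) ≤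
        (Finsupp.applyAddHom Q : Div k A →+ ℤ).ker := by
      rw [AddSubgroup.closure_le]
      rintro _ ⟨R, hR, rfl⟩
      have hne : R ≠ Q := fun h => hQ (h ▸ hR)
      simp [AddMonoidHom.mem_ker, hne]
    exact hle he
  -- The divisor of `c` is `E - e`, and `e` vanishes outside `T`.
  obtain ⟨c, hc⟩ := QuotientAddGroup.eq.1 hmk
  refine ⟨c.toMul, fun Q hQ => ?_⟩
  have h := DFunLike.congr_fun hc Q
  rw [Finsupp.add_apply, Finsupp.neg_apply, hsupp Q hQ, neg_zero, zero_add] at h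
  exact h

/-- The finite place of `k` below a place of `A`. -/
def Place.below (Q : Place k A) : HeightOneSpectrum (𝓞 k) := Q.prime.under (𝓞 k)

theorem Place.liesAbove_iff {Q : Place k A} {p : HeightOneSpectrum (𝓞 k)} :
    Q.LiesAbove p ↔ Q.below = p :=
  ⟨fun h => HeightOneSpectrum.ext h.over.symm, fun h => ⟨(congrArg _ h).symm⟩⟩

theorem Place.mem_placesAbove {Q : Place k A} {S : Set (HeightOneSpectrum (𝓞 k))} :
    Q ∈ placesAbove A S ↔ Q.below ∈ S := by
  simp [placesAbove, Place.liesAbove_iff]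

end Divisors

/-! ### Amitsur differentials and their values in a field -/

section Cochains

variable (k : Type*) [Field k] (F : Type*) [CommRing F] [Algebra k F]

/-- The Amitsur differential `Fˣ → (F ⊗ F)ˣ`, `c ↦ (1 ⊗ c) (c ⊗ 1)⁻¹`. -/
def Δ₀ : UnitGroup F →* C₁ k F :=
  Units.map ((Algebra.TensorProduct.includeRight : F →ₐ[k] F ⊗[k] F) : F →* F ⊗[k] F) *
    (Units.map ((Algebra.TensorProduct.includeLeft : F →ₐ[k] F ⊗[k] F) : F →* F ⊗[k] F))⁻¹

/-- By the cosimplicial identities the six factors are equal in pairs and cancel. -/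
theorem Δ₁_Δ₀ (c : UnitGroup F) : Δ₁ k F (Δ₀ k F c) = 1 := by
  have h1 : Units.map (ε₁ k F : F ⊗[k] F →* F ⊗[k] F ⊗[k] F) (Units.map
      ((Algebra.TensorProduct.includeRight : F →ₐ[k] F ⊗[k] F) : F →* F ⊗[k] F) c) =
    Units.map (ε₀ k F : F ⊗[k] F →* F ⊗[k] F ⊗[k] F) (Units.map
      ((Algebra.TensorProduct.includeRight : F →ₐ[k] F ⊗[k] F) : F →* F ⊗[k] F) c) :=
    by ext; rfl
  have h2 : Units.map (ε₂ k F : F ⊗[k] F →* F ⊗[k] F ⊗[k] F) (Units.map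
      ((Algebra.TensorProduct.includeRight : F →ₐ[k] F ⊗[k] F) : F →* F ⊗[k] F) c) =
    Units.map (ε₀ k F : F ⊗[k] F →* F ⊗[k] F ⊗[k] F) (Units.map
      ((Algebra.TensorProduct.includeLeft : F →ₐ[k] F ⊗[k] F) : F →* F ⊗[k] F) c) :=
    by ext; rfl
  have h3 : Units.map (ε₂ k F : F ⊗[k] F →* F ⊗[k] F ⊗[k] F) (Units.map
      ((Algebra.TensorProduct.includeLeft : F →ₐ[k] F ⊗[k] F) : F →* F ⊗[k] F) c) =
    Units.map (ε₁ k F : F ⊗[k] F →* F ⊗[k] F ⊗[k] F) (Units.map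
      ((Algebra.TensorProduct.includeLeft : F →ₐ[k] F ⊗[k] F) : F →* F ⊗[k] F) c) :=
    by ext; rfl
  simp only [Δ₁, alternatingProduct_apply, Δ₀, MonoidHom.mul_apply, MonoidHom.inv_apply, map_mul,
    map_inv, h1, h2, h3]
  group

variable {k F} {L : Type*} [Field L] [Algebra k L]

open Algebra.TensorProduct (productMap)

theorem productMap_Δ₀ (x y : F →ₐ[k] L) (c : UnitGroup F) :
    productMap x y (Δ₀ k F c : F ⊗[k] F) = y (c : F) * (x (c : F))⁻¹ := by
  have hinv : ((c⁻¹ : UnitGroup F) : F) * c = 1 := c.inv_mul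
  have hx : x ((c⁻¹ : UnitGroup F) : F) = (x c)⁻¹ := by
    refine eq_inv_of_mul_eq_one_left ?_
    rw [← map_mul, hinv, map_one]
  change productMap x y ((1 ⊗ₜ (c : F)) * (((c⁻¹ : UnitGroup F) : F) ⊗ₜ 1)) = _
  simp [hx, mul_comm]

theorem productMap_Δ₁ (x y z : F →ₐ[k] L) (a : C₁ k F) :
    productMap (productMap x y) z (Δ₁ k F a : F ⊗[k] F ⊗[k] F) =
      productMap y z (a : F ⊗[k] F) * (productMap x z (a : F ⊗[k] F))⁻¹ *
        productMap x y (a : F ⊗[k] F) := by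
  have h0 : ∀ w, productMap (productMap x y) z (ε₀ k F w) = productMap y z w := by
    have : (productMap (productMap x y) z).comp (ε₀ k F) = productMap y z := by
      ext w <;> simp [ε₀]
    exact DFunLike.congr_fun this
  have h1 : ∀ w, productMap (productMap x y) z (ε₁ k F w) = productMap x z w := by
    have : (productMap (productMap x y) z).comp (ε₁ k F) = productMap x z := by
      ext w <;> simp [ε₁]
    exact DFunLike.congr_fun this
  have h2 : ∀ w, productMap (productMap x y) z (ε₂ k F w) = productMap x y w := by
    intro w
    simp [ε₂]
  have hinv : productMap x z ((a⁻¹ : C₁ k F) : F ⊗[k] F) = (productMap x z (a : F ⊗[k] F))⁻¹ := by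
    refine eq_inv_of_mul_eq_one_left ?_
    rw [← map_mul, a.inv_mul, map_one]
  change productMap (productMap x y) z
    (ε₀ k F a * ε₁ k F ((a⁻¹ : C₁ k F) : F ⊗[k] F) * ε₂ k F a) = _
  rw [map_mul, map_mul, h0, h1, h2, hinv]

end Cochains

/-! ### The integer cocycle of orders and the construction of `c` -/

section Cocycle

/-- The cocycle relation telescopes along `x, s x, s² x, …`, and invariance makes all the steps
equal. -/
theorem cocycle_apply_iterate {X : Type*} {f : X → X → ℤ}
    (hf : ∀ x y z, f y z - f x z + f x y = 0) {s : X → X} (hs : ∀ x y, f (s x) (s y) = f x y)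
    (n : ℕ) (x : X) : f x (s^[n] x) = n * f x (s x) := by
  induction n generalizing x with
  | zero => have := hf x x x; simpa using this
  | succ n ih =>
    have h1 := hf x (s x) (s^[n] (s x))
    rw [ih, hs] at h1
    rw [Function.iterate_succ_apply]
    push_cast
    linarith

variable {k : Type*} [Field k] [NumberField k] {F : Type*} [CommRing F] [Algebra k F]
  {L : Type*} [Field L] [NumberField L] [Algebra k L]

open Algebra.TensorProduct (productMap)

/-- The order at `P` of the image of `a : (F ⊗ F)ˣ` under `x ⊗ y`. -/
def pairOrd (a : C₁ k F) (P : HeightOneSpectrum (𝓞 L)) (x y : F →ₐ[k] L) : ℤ :=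
  primeOrd P (productMap x y (a : F ⊗[k] F))

theorem pairOrd_galois (a : C₁ k F) {P : HeightOneSpectrum (𝓞 L)} {σ : Gal(L/k)}
    (hσ : σ • P.asIdeal = P.asIdeal) (x y : F →ₐ[k] L) :
    pairOrd a P ((σ : L →ₐ[k] L).comp x) ((σ : L →ₐ[k] L).comp y) = pairOrd a P x y := by
  have h : productMap ((σ : L →ₐ[k] L).comp x) ((σ : L →ₐ[k] L).comp y) =
      (σ : L →ₐ[k] L).comp (productMap x y) := by
    ext w <;> simp
  rw [pairOrd, h]
  exact primeOrd_galois σ hσ _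

/-- With `n` the order of `σ`, going once round the orbit gives `n * f(x, σ x) = f(x, x) = 0`. -/
theorem pairOrd_galois_self {a : C₁ k F} {P : HeightOneSpectrum (𝓞 L)}
    (hf : ∀ x y z, pairOrd a P y z - pairOrd a P x z + pairOrd a P x y = 0) {σ : Gal(L/k)}
    (hσ : σ • P.asIdeal = P.asIdeal) (x : F →ₐ[k] L) :
    pairOrd a P x ((σ : L →ₐ[k] L).comp x) = 0 := by
  let s : (F →ₐ[k] L) → (F →ₐ[k] L) := fun y => (σ : L →ₐ[k] L).comp y
  have hs : ∀ n : ℕ, ∀ w, s^[n] x w = (σ ^ n) (x w) := by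
    intro n w
    induction n with
    | zero => simp
    | succ n ih =>
      rw [Function.iterate_succ_apply', pow_succ', AlgEquiv.mul_apply, ← ih]
      rfl
  have hid : s^[orderOf σ] x = x := by
    ext w
    rw [hs, pow_orderOf_eq_one, AlgEquiv.one_apply]
  have h := cocycle_apply_iterate hf (s := s) (fun x y => pairOrd_galois a hσ x y) (orderOf σ) x
  rw [hid] at h
  have hxx : pairOrd a P x x = 0 := by simpa using hf x x x
  have hn : (orderOf σ : ℤ) ≠ 0 := by exact_mod_cast (orderOf_pos σ).ne'
  rw [hxx] at h
  exact (mul_eq_zero.1 h.symm).resolve_left hn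

theorem map_unit_ne_zero {A : Type*} [CommRing A] [Algebra k A] (φ : A →ₐ[k] L) (a : UnitGroup A) :
    φ (a : A) ≠ 0 :=
  (a.isUnit.map φ).ne_zero

variable [Algebra.Etale k F]

theorem pairOrd_cocycle {a : C₁ k F} {P : HeightOneSpectrum (𝓞 L)}
    (hP : P.asIdeal.ramificationIdx (𝓞 k) = 1)
    (hb : ∀ Q : Place k (F ⊗[k] F ⊗[k] F), Q.LiesAbove (P.under (𝓞 k)) →
      Q.ord (Δ₁ k F a : F ⊗[k] F ⊗[k] F) = 0) (x y z : F →ₐ[k] L) :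
    pairOrd a P y z - pairOrd a P x z + pairOrd a P x y = 0 := by
  obtain ⟨Q, hQ⟩ := Place.exists_isInduced (productMap (productMap x y) z) P
  have h := hQ.ord_eq hP (Δ₁ k F a : F ⊗[k] F ⊗[k] F)
  have hne : ∀ u v : F →ₐ[k] L, productMap u v (a : F ⊗[k] F) ≠ 0 :=
    fun u v => map_unit_ne_zero _ a
  rw [hb Q hQ.liesAbove, productMap_Δ₁, primeOrd_mul _ (mul_ne_zero (hne _ _)
    (inv_ne_zero (hne _ _))) (hne _ _), primeOrd_mul _ (hne _ _) (inv_ne_zero (hne _ _)),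
    primeOrd_inv] at h
  exact h.symm

/-- The main theorem, given a Galois extension of `k` which is generated by the images of `F`. -/
theorem exists_sUnit_of_galois [IsGalois k L]
    (hF : ∀ m : MaximalSpectrum F, Nonempty (Fac k m →ₐ[k] L))
    (hFF : ∀ m : MaximalSpectrum (F ⊗[k] F), Nonempty (Fac k m →ₐ[k] L))
    (hL : ∀ σ : Gal(L/k), (∀ (φ : F →ₐ[k] L) a, σ (φ a) = φ a) → σ = 1)
    {b : C₂ k F} (hb : b ∈ B₂ k F) {S : Set (HeightOneSpectrum (𝓞 k))}
    (hram : ∀ p : HeightOneSpectrum (𝓞 k), Ramifies F p → p ∈ S)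
    (hcl : GeneratesCl k F (placesAbove F S))
    (hsupp : divSupport b ⊆ placesAbove (F ⊗[k] F ⊗[k] F) S) :
    ∃ a ∈ sUnits (placesAbove (F ⊗[k] F) S), Δ₁ k F a = b := by
  classical
  obtain ⟨a₀, rfl⟩ := hb
  have hprime : ∀ p : HeightOneSpectrum (𝓞 k), ∃ P : HeightOneSpectrum (𝓞 L),
      P.under (𝓞 k) = p := by
    intro p
    obtain ⟨P, hP, hover⟩ := Ideal.exists_maximal_ideal_liesOver_of_isIntegral (S := 𝓞 L) p.asIdeal
    refine ⟨⟨P, hP.isPrime, Ideal.ne_bot_of_liesOver_of_ne_bot p.ne_bot P⟩, ?_⟩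
    exact HeightOneSpectrum.ext hover.over.symm
  choose P hPp using hprime
  have hunram : ∀ p ∉ S, (P p).asIdeal.ramificationIdx (𝓞 k) = 1 := fun p hp =>
    ramificationIdx_eq_one_of_forall hL (by rw [hPp]; exact fun h => hp (hram p h))
  have hcoc : ∀ p ∉ S, ∀ x y z,
      pairOrd a₀ (P p) y z - pairOrd a₀ (P p) x z + pairOrd a₀ (P p) x y = 0 := by
    refine fun p hp => pairOrd_cocycle (hunram p hp) fun Q hQ => ?_
    by_contra h
    have := Place.mem_placesAbove.1 (hsupp (mem_divSupport.2 h))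
    rw [Place.liesAbove_iff.1 hQ, hPp] at this
    exact hp this
  have hind : ∀ Q : Place k F, ∃ φ : F →ₐ[k] L, Q.IsInduced φ (P Q.below) := fun Q =>
    Place.exists_isInduced_of_liesAbove (hF _) (by rw [hPp]; exact Place.liesAbove_iff.2 rfl)
  choose φ hφ using hind
  have hind₂ : ∀ Q : Place k (F ⊗[k] F), ∃ x y : F →ₐ[k] L,
      Q.IsInduced (productMap x y) (P Q.below) := by
    intro Q
    obtain ⟨ψ, hψ⟩ := Place.exists_isInduced_of_liesAbove (hFF Q.factor) (P := P Q.below)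
      (by rw [hPp]; exact Place.liesAbove_iff.2 rfl)
    refine ⟨ψ.comp Algebra.TensorProduct.includeLeft, ψ.comp Algebra.TensorProduct.includeRight, ?_⟩
    convert hψ
    ext w <;> simp [← map_mul]
  -- Without homomorphisms to `L`, the algebra `F ⊗ F` has no places and `a₀` itself works.
  rcases isEmpty_or_nonempty (F →ₐ[k] L) with hX | ⟨⟨x₀⟩⟩
  · exact ⟨a₀, fun Q _ => (hX.false (hind₂ Q).choose).elim, rfl⟩
  -- This is the potential `g` based at `x₀`, evaluated at a chosen representative `φ Q` of the
  -- orbit belonging to `Q`.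
  let E : Place k F → ℤ := fun Q => if Q.below ∈ S then 0 else pairOrd a₀ (P Q.below) x₀ (φ Q)
  have hE : (Function.support E).Finite := by
    have := finite_of_etale k F
    have hfin : ((Place.below '' {Q : Place k (F ⊗[k] F) | Q.ord (a₀ : F ⊗[k] F) ≠ 0}) ×ˢ
        (Set.univ : Set (F →ₐ[k] L))).Finite :=
      ((finite_ord_ne_zero a₀).image _).prod Set.finite_univ
    -- The pair `(Q.below, φ Q)` determines `Q`. If `E Q ≠ 0`, then `a₀` has nonzero order at some
    -- place above `Q.below`, which leaves finitely many pairs.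
    refine Set.Finite.of_injOn (f := fun Q : Place k F => (Q.below, φ Q)) ?_ ?_ hfin
    · intro Q hQ
      have hQS : Q.below ∉ S := fun h => hQ (if_pos h)
      have hQ' : pairOrd a₀ (P Q.below) x₀ (φ Q) ≠ 0 := fun h => hQ ((if_neg hQS).trans h)
      obtain ⟨R, hR⟩ := Place.exists_isInduced (productMap x₀ (φ Q)) (P Q.below)
      refine ⟨⟨R, ?_, ?_⟩, trivial⟩
      · rw [Set.mem_ofPred_eq, hR.ord_eq (hunram _ hQS)]
        exact hQ'
      · rw [Place.liesAbove_iff.1 hR.liesAbove, hPp]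
    · intro Q _ Q' _ h
      obtain ⟨h1, h2⟩ := Prod.mk.inj h
      refine (hφ Q).unique ?_
      rw [h1, h2]
      exact hφ Q'
  obtain ⟨c, hc⟩ := hcl.exists_ord_eq (Finsupp.ofSupportFinite E hE)
  have hord : ∀ p ∉ S, ∀ x : F →ₐ[k] L, primeOrd (P p) (x c) = pairOrd a₀ (P p) x₀ x := by
    intro p hp x
    obtain ⟨Q, hQ⟩ := Place.exists_isInduced x (P p)
    obtain rfl : Q.below = p := by rw [Place.liesAbove_iff.1 hQ.liesAbove, hPp]
    rw [← hQ.ord_eq (hunram _ hp), hc Q (fun h => hp (Place.mem_placesAbove.1 h))]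
    change E Q = _
    rw [show E Q = _ from if_neg hp]
    -- Independence of the representative: `x` and `φ Q` differ by an element of the decomposition
    -- group, along which the potential is constant.
    obtain ⟨σ, hσ, hx⟩ := (hφ Q).exists_galois hQ
    obtain rfl : x = (σ : L →ₐ[k] L).comp (φ Q) := AlgHom.ext hx
    have h1 := pairOrd_galois_self (hcoc _ hp) hσ (φ Q)
    have h2 := hcoc _ hp x₀ (φ Q) ((σ : L →ₐ[k] L).comp (φ Q))
    linarith
  refine ⟨a₀ * (Δ₀ k F c)⁻¹, fun Q hQ => ?_, by rw [map_mul, map_inv, Δ₁_Δ₀, inv_one, mul_one]⟩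
  by_contra hQS
  rw [Place.mem_placesAbove] at hQS
  refine mem_divSupport.1 hQ ?_
  obtain ⟨x, y, hxy⟩ := hind₂ Q
  have hsplit := Q.ord_mul a₀ (Δ₀ k F c)⁻¹
  have hneg := Q.ord_mul (Δ₀ k F c) (Δ₀ k F c)⁻¹
  rw [mul_inv_cancel, Units.val_one, Q.ord_one, hxy.ord_eq (hunram _ hQS) (Δ₀ k F c : F ⊗[k] F),
    productMap_Δ₀, primeOrd_mul _ (map_unit_ne_zero y c) (inv_ne_zero (map_unit_ne_zero x c)),
    primeOrd_inv, hord _ hQS, hord _ hQS] at hneg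
  rw [hxy.ord_eq (hunram _ hQS) (a₀ : F ⊗[k] F)] at hsplit
  -- The order of `Δ₀ c` at `Q` is `g(y) - g(x)`, which by this relation is the order of `a₀`.
  have h := hcoc _ hQS x₀ x y
  rw [pairOrd] at h
  linarith

end Cocycle

/-! ### The Galois extension generated by the images of `F` -/

section SplittingField

variable (k : Type*) [Field k] (F : Type*) [CommRing F] [Algebra k F] [Module.Finite k F]

/-- The subfield of an algebraic closure of `k` generated by the images of `F`. -/
def splittingField : IntermediateField k (AlgebraicClosure k) :=
  IntermediateField.adjoin k (⋃ φ : F →ₐ[k] AlgebraicClosure k, φ '' Set.range (Module.finBasis k F))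

/-- Adjoining only the images of a basis keeps the generating set finite. -/
instance : FiniteDimensional k (splittingField k F) := by
  have : Finite (⋃ φ : F →ₐ[k] AlgebraicClosure k, φ '' Set.range (Module.finBasis k F) :
    Set (AlgebraicClosure k)) := Set.finite_iUnion fun φ => (Set.finite_range _).image _
  exact IntermediateField.finiteDimensional_adjoin fun x _ => Algebra.IsIntegral.isIntegral x

variable {k F}

theorem mem_splittingField (φ : F →ₐ[k] AlgebraicClosure k) (a : F) : φ a ∈ splittingField k F := by
  rw [← (Module.finBasis k F).sum_repr a, map_sum]
  refine sum_mem fun i _ => ?_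
  rw [map_smul]
  refine IntermediateField.smul_mem _ (IntermediateField.subset_adjoin _ _ ?_)
  exact Set.mem_iUnion.2 ⟨φ, _, ⟨i, rfl⟩, rfl⟩

/-- Composition with an automorphism sends homomorphisms from `F` to homomorphisms from `F`. -/
instance : Normal k (splittingField k F) := by
  rw [IntermediateField.normal_iff_forall_map_le]
  intro σ
  rw [splittingField, IntermediateField.adjoin_map, IntermediateField.adjoin_le_iff]
  rintro _ ⟨x, hx, rfl⟩
  obtain ⟨φ, _, ⟨i, rfl⟩, rfl⟩ := Set.mem_iUnion.1 hx
  exact mem_splittingField (σ.comp φ) _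

theorem eq_one_of_fixes_images (σ : Gal(splittingField k F/k))
    (h : ∀ (φ : F →ₐ[k] splittingField k F) a, σ (φ a) = φ a) : σ = 1 := by
  suffices hx : ∀ x (hx : x ∈ splittingField k F), (σ ⟨x, hx⟩ : AlgebraicClosure k) = x by
    ext x
    exact hx x x.2
  intro x hx
  induction hx using IntermediateField.adjoin_induction with
  | mem x hx =>
    obtain ⟨φ, a, -, rfl⟩ := Set.mem_iUnion.1 hx
    exact congrArg Subtype.val (h (φ.codRestrict (splittingField k F).toSubalgebra
      (mem_splittingField φ)) a)
  | algebraMap r => exact congrArg Subtype.val (σ.commutes r)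
  | add x y hx hy ihx ihy =>
    have := congrArg Subtype.val (map_add σ ⟨x, hx⟩ ⟨y, hy⟩)
    exact this.trans (congrArg₂ (· + ·) ihx ihy)
  | mul x y hx hy ihx ihy =>
    have := congrArg Subtype.val (map_mul σ ⟨x, hx⟩ ⟨y, hy⟩)
    exact this.trans (congrArg₂ (· * ·) ihx ihy)
  | inv x hx ihx =>
    have := congrArg Subtype.val (map_inv₀ σ ⟨x, hx⟩)
    exact this.trans (congrArg (·⁻¹) ihx)

theorem nonempty_factor_algHom {A : Type*} [CommRing A] [Algebra k A] [Module.Finite k A]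
    (hA : ∀ (φ : A →ₐ[k] AlgebraicClosure k) a, φ a ∈ splittingField k F) (m : MaximalSpectrum A) :
    Nonempty (Fac k m →ₐ[k] splittingField k F) := by
  have : Module.Finite k (Fac k m) := inferInstanceAs (Module.Finite k (A ⧸ m.asIdeal))
  let ψ : Fac k m →ₐ[k] AlgebraicClosure k := IsAlgClosed.lift
  refine ⟨ψ.codRestrict (splittingField k F).toSubalgebra fun z => ?_⟩
  obtain ⟨a, rfl⟩ : ∃ a, algebraMap A (Fac k m) a = z := Ideal.Quotient.mk_surjective z
  exact hA (ψ.comp (IsScalarTower.toAlgHom k A _)) a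

theorem mem_splittingField_of_tensor (φ : F ⊗[k] F →ₐ[k] AlgebraicClosure k) (a : F ⊗[k] F) :
    φ a ∈ splittingField k F := by
  induction a with
  | zero => simp
  | add x y hx hy => rw [map_add]; exact add_mem hx hy
  | tmul x y =>
    rw [← one_mul y, ← mul_one x, ← Algebra.TensorProduct.tmul_mul_tmul, map_mul]
    exact mul_mem (mem_splittingField (φ.comp Algebra.TensorProduct.includeLeft) x)
      (mem_splittingField (φ.comp Algebra.TensorProduct.includeRight) y)

end SplittingField

end AmitsurEtale

end

theorem mainTheorem2 {k : Type*} [Field k] [NumberField k]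
    {F : Type*} [CommRing F] [Algebra k F] [Algebra.Etale k F]
    (b : AmitsurEtale.C₂ k F) (hb : b ∈ AmitsurEtale.B₂ k F)
    (S : Set (HeightOneSpectrum (𝓞 k)))
    (hram : ∀ p : HeightOneSpectrum (𝓞 k), AmitsurEtale.Ramifies F p → p ∈ S)
    (hcl : AmitsurEtale.GeneratesCl k F (AmitsurEtale.placesAbove F S))
    (hsupp : AmitsurEtale.divSupport b ⊆ AmitsurEtale.placesAbove (F ⊗[k] F ⊗[k] F) S) :
    ∃ a ∈ AmitsurEtale.sUnits (AmitsurEtale.placesAbove (F ⊗[k] F) S),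
      AmitsurEtale.Δ₁ k F a = b := by
  have := AmitsurEtale.finite_of_etale k F
  have := AmitsurEtale.finite_of_etale k (F ⊗[k] F)
  have : NumberField (AmitsurEtale.splittingField k F) :=
    { to_charZero := inferInstance
      to_finiteDimensional := Module.Finite.trans k _ }
  -- Separability is automatic in characteristic zero.
  have : IsGalois k (AmitsurEtale.splittingField k F) := ⟨⟩
  exact AmitsurEtale.exists_sUnit_of_galois (L := AmitsurEtale.splittingField k F)
    (AmitsurEtale.nonempty_factor_algHom AmitsurEtale.mem_splittingField)
    (AmitsurEtale.nonempty_factor_algHom AmitsurEtale.mem_splittingField_of_tensor)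
    AmitsurEtale.eq_one_of_fixes_images hb hram hcl hsupp
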